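/- All graphs are finite and loopless, and may have parallel edges. For a graph $G$ and $S\subseteq V(G)$, let $E_G(S)$ be the set of edges of $G$ with exactly one end in $S$, and for $x\in S$ let $C_G(S,x)$ be the vertex set of the connected component of the induced subgraph $G[S]$ that contains $x$. The edge-degree of a vertex $x$ is $|E_G(\{x\})|$, and $\Delta_{\mathsf e}(G)$ denotes the maximum edge-degree of a vertex of $G$. A layout of $G$ is a linear ordering $L=\langle x_1,\dots,x_n\rangle$ of $V(G)$; put $S_i=\{x_i,\dots,x_n\}$. The edge-treewidth of $G$ is $$\mathbf{etw}(G)=\min_{L}\ \max_{1\le i\le n}\ \bigl|E_G\bigl(C_G(S_i,x_i)\bigr)\bigr|,$$ the minimum being over all layouts $L$ of $G$. Let $\mathbf{tw}$ denote treewidth. A graph is 2-connected if it is connected, has no cut vertex and has at least two edges (in particular, two vertices joined by at least two parallel edges form a 2-connected graph). A block of $G$ is either a bridge of $G$ (together with its two ends) or a maximal 2-connected subgraph of $G$. Let $$\mathbf p(G)=\max\bigl\{\mathbf{tw}(B),\ \Delta_{\mathsf e}(B)\ :\ B\text{ a block of }G\bigr\},$$ with $\mathbf p(G)=0$ if $G$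 has no edges. Then $\mathbf{etw}$ and $\mathbf p$ are parametrically equivalent, that is, there are functions $f,g:\mathbb N\to\mathbb N$ such that $\mathbf{etw}(G)\le f(\mathbf p(G))$ and $\mathbf p(G)\le g(\mathbf{etw}(G))$ for every graph $G$. Explicitly, for every graph $G$, $$\sqrt{\mathbf p(G)}\ \le\ \mathbf{etw}(G)\ \le\ \mathbf p(G)^4+2\,\mathbf p(G)^2 .$$ -/

import Mathlib

/-! Finite loopless multigraphs are terms `G : Graph α β` of Mathlib's multigraph type with
`G.vertexSet` and `G.edgeSet` finite and `G.Loopless`. -/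

universe u v

noncomputable section

namespace Graph

/-- `E_G(S)`: the set of edges with one end in `S` and the other end not in `S`. -/
def edgeBoundary {α : Type u} {β : Type v} (G : Graph α β) (S : Set α) : Set β :=
  {e | ∃ x y, G.IsLink e x y ∧ x ∈ S ∧ y ∉ S}

/-- The edge-degree `|E_G({x})|` of a vertex. -/
def edgeDegree {α : Type u} {β : Type v} (G : Graph α β) (x : α) : ℕ :=
  (G.edgeBoundary {x}).ncard

/-- The maximum edge-degree of a graph. -/
def maxEdgeDegree {α : Type u} {β : Type v} (G : Graph α β) : ℕ :=
  sSup {n | ∃ x ∈ V(G), n = G.edgeDegree x}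

/-- `x` and `y` are joined by a walk of `G`. -/
def Joined {α : Type u} {β : Type v} (G : Graph α β) (x y : α) : Prop :=
  Relation.ReflTransGen G.Adj x y

/-- `C_G(S, x)`: the vertex set of the connected component of `G[S]` that contains `x`
(for `S ⊆ V(G)` and `x ∈ S`). -/
def componentIn {α : Type u} {β : Type v} (G : Graph α β) (S : Set α) (x : α) : Set α :=
  {y | (G.induce S).Joined x y}

/-- A layout of a finite graph: an enumeration of its vertices, without repetition. -/
abbrev Layout {α : Type u} {β : Type v} (G : Graph α β) : Type u :=
  Fin V(G).ncard ≃ V(G)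

/-- `S_i`: the set of vertices at position `i` or later. -/
def Layout.tail {α : Type u} {β : Type v} {G : Graph α β} (L : G.Layout)
    (i : Fin V(G).ncard) : Set α :=
  {x | ∃ j, i ≤ j ∧ (L j : α) = x}

/-- The cost `|E_G(C_G(S_i, x_i))|` of position `i`. -/
def Layout.edgeCost {α : Type u} {β : Type v} {G : Graph α β} (L : G.Layout)
    (i : Fin V(G).ncard) : ℕ :=
  (G.edgeBoundary (G.componentIn (L.tail i) (L i))).ncard

/-- The maximum cost of a position of the layout. -/
def Layout.maxEdgeCost {α : Type u} {β : Type v} {G : Graph α β} (L : G.Layout) : ℕ :=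
  Finset.univ.sup L.edgeCost

/-- Edge-treewidth: the minimum over all layouts of the maximum cost of a position. -/
def edgeTreewidth {α : Type u} {β : Type v} (G : Graph α β) : ℕ :=
  sInf {k | ∃ L : G.Layout, k = L.maxEdgeCost}

/-- Tree decompositions of `G`, over finite trees. -/
structure TreeDecomposition {α : Type u} {β : Type v} (G : Graph α β) where
  /-- the nodes of the tree -/
  Node : Type u
  /-- there are finitely many nodes -/
  finite_node : Finite Node
  /-- the tree -/
  tree : SimpleGraph Node
  isTree : tree.IsTree
  /-- the bag of a node -/
  bag : Node → Set α
  bag_subset : ∀ t, bag t ⊆ V(G)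
  exists_mem_bag : ∀ x ∈ V(G), ∃ t, x ∈ bag t
  exists_link_bag : ∀ e x y, G.IsLink e x y → ∃ t, x ∈ bag t ∧ y ∈ bag t
  bag_connected : ∀ x ∈ V(G), (tree.induce {t | x ∈ bag t}).Preconnected

/-- Treewidth: the least `k` such that some tree decomposition has all bags of size at most
`k + 1`. -/
def treewidth {α : Type u} {β : Type v} (G : Graph α β) : ℕ :=
  sInf {k | ∃ D : G.TreeDecomposition, ∀ t, (D.bag t).ncard ≤ k + 1}

/-- Any two vertices are joined by a walk. -/
def IsPreconnected {α : Type u} {β : Type v} (G : Graph α β) : Prop :=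
  ∀ x ∈ V(G), ∀ y ∈ V(G), G.Joined x y

/-- A loopless multigraph is 2-connected if it is connected, has no cut vertex, and has at least
two edges (so two vertices joined by parallel edges, the cycle of length two in particular, count
as 2-connected, while a one-vertex graph and a single edge do not). -/
structure IsTwoConnected {α : Type u} {β : Type v} (G : Graph α β) : Prop where
  preconnected : G.IsPreconnected
  deleteVert_preconnected : ∀ x ∈ V(G), (G.deleteVerts {x}).IsPreconnected
  two_edges : E(G).Nontrivial

/-- A bridge: an edge whose removal separates its ends. -/
def IsBridge {α : Type u} {β : Type v} (G : Graph α β) (e : β) : Prop :=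
  ∃ x y, G.IsLink e x y ∧ ¬ (G.deleteEdges {e}).Joined x y

/-- A block of `G` is a bridge of `G` together with its two ends, or a maximal 2-connected subgraph
of `G`. -/
def IsBlock {α : Type u} {β : Type v} (G B : Graph α β) : Prop :=
  (∃ e x y, G.IsBridge e ∧ G.IsLink e x y ∧ B = Graph.banana x y {e}) ∨
    Maximal (fun H : Graph α β => H ≤ G ∧ H.IsTwoConnected) B

/-- The maximum of the treewidth and the maximum edge-degree of `B`, over all blocks `B` of `G`
(it is `0` if there are no blocks, that is, if `G` has no edges). -/
def blockParameter {α : Type u} {β : Type v} (G : Graph α β) : ℕ :=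
  sSup {n | ∃ B, G.IsBlock B ∧ (n = B.treewidth ∨ n = B.maxEdgeDegree)}

end Graph

/-- Functions from graphs to non-negative integers. -/
abbrev GraphParameter : Type (max (u + 1) (v + 1)) :=
  ∀ (α : Type u) (β : Type v), Graph α β → ℕ

/-- `p ≲ q`: there is a function `f` with `p(G) ≤ f(q(G))` for all finite loopless multigraphs. -/
def GraphParameter.UpperBoundedBy (p q : GraphParameter.{u, v}) : Prop :=
  ∃ f : ℕ → ℕ, ∀ (α : Type u) (β : Type v) (G : Graph α β),
    G.vertexSet.Finite → G.edgeSet.Finite → G.Loopless → p α β G ≤ f (q α β G)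

/-- Parametric equivalence of graph parameters. -/
def GraphParameter.ParametricallyEquivalent (p q : GraphParameter.{u, v}) : Prop :=
  q.UpperBoundedBy p ∧ p.UpperBoundedBy q

end

/-! Write `k` for the edge-treewidth and `p` for the block parameter. Both inequalities `p ≤ k ^ 2`
and `k ≤ p ^ 2` are proved; the second is stronger than the stated upper bound. Layouts are replaced
by injective rankings `f : α → ℕ` (`IsRanking`), which restrict to subgraphs without increasing the
cost (`IsRanking.anti`).

For `p ≤ k ^ 2`, restrict an optimal ranking to a block. The bags consisting of `x` and the outer
neighbours of its tail component form a tree decomposition of width at most `k`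
(`IsRanking.exists_treeDecomposition`). If `x` is not a cut vertex, the edges at `x` are charged to
the boundary of its tail component, at most `k` to each boundary edge, so the degree is at most `k ^
2` (`IsRanking.edgeDegree_le`).

For `k ≤ p ^ 2`, root a tree decomposition of a block at a bag containing a chosen vertex, and rank
vertices by the depth of their topmost bag. The outer neighbours of a tail component then lie in one
bag, so the cost is at most treewidth times maximum degree (`TreeDecomposition.exists_isRanking`).
Since the first vertex can be prescribed, the rankings of the blocks can be glued along cut vertices
at no extra cost (`IsSeparation.exists_isRanking`). -/

namespace Graph

variable {α : Type u} {β : Type v} {G H : Graph α β} {S T : Set α} {x y : α} {f : α → ℕ} {k : ℕ}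

/-! ### Components of induced subgraphs -/

lemma Joined.symm (h : G.Joined x y) : G.Joined y x :=
  haveI : Std.Symm G.Adj := ⟨fun _ _ h => Adj.symm h⟩
  Relation.ReflTransGen.stdSymm.symm _ _ h

lemma self_mem_componentIn (G : Graph α β) (S : Set α) (x : α) : x ∈ G.componentIn S x :=
  Relation.ReflTransGen.refl

lemma componentIn_subset (G : Graph α β) (hx : x ∈ S) : G.componentIn S x ⊆ S := by
  intro y hy
  induction hy with
  | refl => exact hx
  | tail _ h _ => exact h.right_mem

lemma mem_componentIn_of_isLink {e : β} {a b : α} (hx : x ∈ S) (ha : a ∈ G.componentIn S x)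
    (h : G.IsLink e a b) (hb : b ∈ S) : b ∈ G.componentIn S x :=
  Relation.ReflTransGen.tail ha ⟨e, h, G.componentIn_subset hx ha, hb⟩

lemma notMem_of_notMem_componentIn {e : β} {a b : α} (hx : x ∈ S) (ha : a ∈ G.componentIn S x)
    (h : G.IsLink e a b) (hb : b ∉ G.componentIn S x) : b ∉ S :=
  fun h' => hb (mem_componentIn_of_isLink hx ha h h')

lemma componentIn_mono (hHG : H ≤ G) (hST : S ⊆ T) (x : α) :
    H.componentIn S x ⊆ G.componentIn T x := by
  intro y hy
  refine Relation.ReflTransGen.mono ?_ _ _ hy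
  rintro a b ⟨e, he, ha, hb⟩
  exact ⟨e, he.mono hHG, hST ha, hST hb⟩

lemma componentIn_eq_of_mem (h : y ∈ G.componentIn S x) :
    G.componentIn S y = G.componentIn S x := by
  ext z
  exact ⟨fun hz => Relation.ReflTransGen.trans h hz,
    fun hz => Relation.ReflTransGen.trans (Joined.symm h) hz⟩

/-- A walk in the component never leaves the component, so only the component itself, not all of
`S`, has to lie in `T`. -/
lemma componentIn_subset_of_subset (hCS : G.componentIn S x ⊆ T) :
    G.componentIn S x ⊆ G.componentIn T x := by
  intro y hy
  induction hy with
  | refl => exact G.self_mem_componentIn T x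
  | @tail a b h hab ih =>
    obtain ⟨e, he, ha, hb⟩ := hab
    exact Relation.ReflTransGen.tail ih
      ⟨e, he, hCS h, hCS (Relation.ReflTransGen.tail h ⟨e, he, ha, hb⟩)⟩

lemma edgeBoundary_subset (G : Graph α β) (S : Set α) : G.edgeBoundary S ⊆ E(G) := by
  rintro e ⟨a, b, h, -⟩
  exact h.edge_mem

/-! ### Rankings -/

/-- The vertices whose rank is at least that of `x`. -/
def tailOf (G : Graph α β) (f : α → ℕ) (x : α) : Set α := {y | y ∈ V(G) ∧ f x ≤ f y}

/-- The component of `x` in the graph induced by the vertices ranked at `x` or later. -/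
def tailComponent (G : Graph α β) (f : α → ℕ) (x : α) : Set α :=
  G.componentIn (G.tailOf f x) x

/-- `f` ranks the vertices of `G` injectively, and in the corresponding layout every position
has edge cost at most `k`. -/
structure IsRanking (G : Graph α β) (f : α → ℕ) (k : ℕ) : Prop where
  injOn : Set.InjOn f V(G)
  cost_le : ∀ x ∈ V(G), (G.edgeBoundary (G.tailComponent f x)).ncard ≤ k

lemma mem_tailOf_self (hx : x ∈ V(G)) : x ∈ G.tailOf f x := ⟨hx, le_rfl⟩

lemma mem_tailComponent_self (G : Graph α β) (f : α → ℕ) (x : α) : x ∈ G.tailComponent f x :=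
  G.self_mem_componentIn _ x

lemma tailComponent_subset (hx : x ∈ V(G)) : G.tailComponent f x ⊆ G.tailOf f x :=
  G.componentIn_subset (mem_tailOf_self hx)

lemma lt_of_notMem_tailComponent {e : β} {a b : α} (hx : x ∈ V(G))
    (ha : a ∈ G.tailComponent f x) (h : G.IsLink e a b) (hb : b ∉ G.tailComponent f x) :
    f b < f x := by
  by_contra! hlt
  exact notMem_of_notMem_componentIn (mem_tailOf_self hx) ha h hb ⟨h.right_mem, hlt⟩

lemma notMem_tailComponent_of_lt (hx : x ∈ V(G)) (h : f y < f x) : y ∉ G.tailComponent f x :=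
  fun hy => absurd (tailComponent_subset hx hy).2 (by omega)

/-- Tail components shrink in a subgraph, but an edge leaving the smaller one ends at an earlier
vertex, which lies outside the larger one too. -/
lemma IsRanking.anti (hf : G.IsRanking f k) (hE : E(G).Finite) (hHG : H ≤ G) :
    H.IsRanking f k where
  injOn := hf.injOn.mono hHG.vertexSet_mono
  cost_le x hx := by
    refine le_trans (Set.ncard_le_ncard ?_ (hE.subset (G.edgeBoundary_subset _)))
      (hf.cost_le x (hHG.vertexSet_mono hx))
    rintro e ⟨a, b, h, ha, hb⟩
    refine ⟨a, b, h.mono hHG, ?_, notMem_tailComponent_of_lt (hHG.vertexSet_mono hx)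
      (lt_of_notMem_tailComponent hx ha h hb)⟩
    exact componentIn_mono hHG (T := G.tailOf f x)
      (fun z hz => ⟨hHG.vertexSet_mono hz.1, hz.2⟩) x ha

lemma isRanking_of_injOn (hE : E(G).Finite) (hf : Set.InjOn f V(G)) :
    G.IsRanking f E(G).ncard :=
  ⟨hf, fun _ _ => Set.ncard_le_ncard (G.edgeBoundary_subset _) hE⟩

lemma IsRanking.mono {l : ℕ} (hf : G.IsRanking f k) (hkl : k ≤ l) : G.IsRanking f l :=
  ⟨hf.injOn, fun x hx => (hf.cost_le x hx).trans hkl⟩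

lemma exists_injOn_of_finite {s : Set α} (hs : s.Finite) : ∃ f : α → ℕ, Set.InjOn f s := by
  exact Set.countable_iff_exists_injOn.1 hs.countable

/-- Every layout comes from a ranking. -/
lemma exists_isRanking_of_layout (L : G.Layout) : ∃ f, G.IsRanking f L.maxEdgeCost := by
  classical
  let f : α → ℕ := fun x => if h : x ∈ V(G) then (L.symm ⟨x, h⟩ : ℕ) else 0
  have hfL : ∀ i, f (L i) = i := by
    intro i
    simp [f, (L i).2]
  have hLx : ∀ x ∈ V(G), ∃ i, (L i : α) = x := fun x hx => ⟨L.symm ⟨x, hx⟩, by simp⟩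
  refine ⟨f, ?_, ?_⟩
  · intro x hx y hy hxy
    obtain ⟨i, rfl⟩ := hLx x hx
    obtain ⟨j, rfl⟩ := hLx y hy
    rw [hfL, hfL] at hxy
    rw [Fin.ext hxy]
  · intro x hx
    obtain ⟨i, rfl⟩ := hLx x hx
    have htail : L.tail i = G.tailOf f (L i) := by
      ext y
      constructor
      · rintro ⟨j, hij, rfl⟩
        refine ⟨(L j).2, ?_⟩
        rw [hfL, hfL]
        exact hij
      · rintro ⟨hy, hle⟩
        obtain ⟨j, rfl⟩ := hLx y hy
        rw [hfL, hfL] at hle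
        exact ⟨j, hle, rfl⟩
    have := Finset.le_sup (f := L.edgeCost) (Finset.mem_univ i)
    rw [Layout.edgeCost, htail] at this
    exact this

/-- Every ranking of a finite graph comes from a layout. -/
lemma IsRanking.exists_layout (hV : V(G).Finite) (hf : G.IsRanking f k) :
    ∃ L : G.Layout, L.maxEdgeCost ≤ k := by
  classical
  have := hV.fintype
  let : LinearOrder V(G) := LinearOrder.lift' (fun x : V(G) => f x)
    (fun x y h => Subtype.ext (hf.injOn x.2 y.2 h))
  have hcard : Fintype.card V(G) = V(G).ncard := by
    rw [← Nat.card_coe_set_eq, Nat.card_eq_fintype_card]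
  let L := monoEquivOfFin V(G) hcard
  refine ⟨L.toEquiv, Finset.sup_le fun i _ => ?_⟩
  have htail : Layout.tail (G := G) L.toEquiv i = G.tailOf f (L i) := by
    ext y
    constructor
    · rintro ⟨j, hij, rfl⟩
      exact ⟨(L j).2, L.monotone hij⟩
    · rintro ⟨hy, hle⟩
      refine ⟨L.symm ⟨y, hy⟩, ?_, by simp⟩
      rw [← L.le_iff_le]
      change f (L i) ≤ f (L (L.symm ⟨y, hy⟩))
      simpa using hle
  rw [Layout.edgeCost, htail]
  exact hf.cost_le _ (L i).2

lemma IsRanking.edgeTreewidth_le (hV : V(G).Finite) (hf : G.IsRanking f k) :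
    G.edgeTreewidth ≤ k := by
  obtain ⟨L, hL⟩ := hf.exists_layout hV
  exact le_trans (Nat.sInf_le (show L.maxEdgeCost ∈ _ from ⟨L, rfl⟩)) hL

lemma exists_isRanking_edgeTreewidth (hV : V(G).Finite) (hE : E(G).Finite) :
    ∃ f, G.IsRanking f G.edgeTreewidth := by
  obtain ⟨f, hf⟩ := exists_injOn_of_finite hV
  obtain ⟨L, -⟩ := (isRanking_of_injOn hE hf).exists_layout hV
  obtain ⟨L', hL'⟩ := Nat.sInf_mem (s := {k | ∃ L : G.Layout, k = L.maxEdgeCost}) ⟨_, L, rfl⟩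
  have : G.edgeTreewidth = L'.maxEdgeCost := hL'
  rw [this]
  exact exists_isRanking_of_layout L'

end Graph

namespace Graph

variable {α : Type u} {β : Type v} {G H : Graph α β} {S T : Set α} {x y : α} {f : α → ℕ} {k : ℕ}

/-! ### Tree decompositions from rankings -/

/-- The vertices outside `S` with a neighbour in `S`. -/
def outerNeighbors (G : Graph α β) (S : Set α) : Set α :=
  {b | ∃ a e, G.IsLink e a b ∧ a ∈ S ∧ b ∉ S}

lemma outerNeighbors_subset (G : Graph α β) (S : Set α) : G.outerNeighbors S ⊆ V(G) := by
  rintro b ⟨a, e, h, -⟩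
  exact h.right_mem

/-- Choosing for each outer neighbour an edge into `S` is injective: such an edge has only one end
outside `S`. -/
lemma ncard_outerNeighbors_le (hE : E(G).Finite) (S : Set α) :
    (G.outerNeighbors S).ncard ≤ (G.edgeBoundary S).ncard := by
  obtain h | ⟨b, a, e, -⟩ := (G.outerNeighbors S).eq_empty_or_nonempty
  · simp [h]
  have : Nonempty β := ⟨e⟩
  have key : ∀ b ∈ G.outerNeighbors S, ∃ e, ∃ a ∈ S, G.IsLink e a b := by
    rintro b ⟨a, e, h, ha, -⟩
    exact ⟨e, a, ha, h⟩
  choose! g hg using key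
  refine Set.ncard_le_ncard_of_injOn g ?_ ?_ (hE.subset (G.edgeBoundary_subset S))
  · intro b hb
    obtain ⟨a, ha, h⟩ := hg b hb
    exact ⟨a, b, h, ha, hb.choose_spec.choose_spec.2.2⟩
  · intro b hb c hc hbc
    obtain ⟨a, ha, h⟩ := hg b hb
    obtain ⟨a', ha', h'⟩ := hg c hc
    rw [← hbc] at h'
    obtain h1 | h1 := h.right_eq_or_eq h'
    · exact absurd (h1 ▸ ha') hb.choose_spec.choose_spec.2.2
    · exact h1

lemma Joined.exists_isLink_of_mem_of_notMem (h : G.Joined x y) (hx : x ∈ S) (hy : y ∉ S) :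
    ∃ e a b, G.IsLink e a b ∧ a ∈ S ∧ b ∉ S := by
  induction h with
  | refl => exact absurd hx hy
  | @tail a b _ hab ih =>
    by_cases ha : a ∈ S
    · exact ⟨_, a, b, hab.choose_spec, ha, hy⟩
    · exact ih ha

/-- A parent function that decreases a rank defines a tree. -/
lemma exists_isTree_of_parent {V : Type*} [Finite V] (r : V) (p : V → V) (f : V → ℕ)
    (hp : ∀ x ≠ r, f (p x) < f x) :
    ∃ T : SimpleGraph V, T.IsTree ∧ ∀ x ≠ r, T.Adj x (p x) := by
  classical
  let T : SimpleGraph V := SimpleGraph.fromRel (fun x y => x ≠ r ∧ y = p x)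
  have hadj : ∀ x ≠ r, T.Adj x (p x) := fun x hx => by
    refine ⟨fun h => ?_, Or.inl ⟨hx, rfl⟩⟩
    have := hp x hx
    rw [← h] at this
    exact lt_irrefl _ this
  have hreach : ∀ n x, f x = n → T.Reachable x r := by
    intro n
    induction n using Nat.strong_induction_on with
    | _ n ih =>
      intro x hx
      by_cases hxr : x = r
      · exact hxr ▸ SimpleGraph.Reachable.refl _
      · exact (hadj x hxr).reachable.trans (ih _ (hx ▸ hp x hxr) _ rfl)
  have hconn : T.Connected :=
    { preconnected := fun x y => (hreach _ x rfl).trans (hreach _ y rfl).symm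
      nonempty := ⟨r⟩ }
  refine ⟨T, SimpleGraph.isTree_iff_connected_and_card.2 ⟨hconn, ?_⟩, hadj⟩
  refine le_antisymm ?_ hconn.card_vert_le_card_edgeSet_add_one
  -- Each edge joins a non-root vertex to its parent, so there are at most `|V| - 1` edges; a
  -- connected graph with so few edges is a tree.
  have hsub : T.edgeSet ⊆ (fun x => s(x, p x)) '' {x | x ≠ r} := by
    intro e
    induction e with
    | _ a b =>
      rintro ⟨-, ⟨ha, hb⟩ | ⟨hb, ha⟩⟩
      · exact ⟨a, ha, by rw [show b = p a from hb]⟩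
      · exact ⟨b, hb, by rw [show a = p b from ha, Sym2.eq_swap]⟩
  have h1 : Nat.card T.edgeSet ≤ ({x | x ≠ r} : Set V).ncard := by
    rw [Nat.card_coe_set_eq]
    exact (Set.ncard_le_ncard hsub (Set.toFinite _)).trans (Set.ncard_image_le (Set.toFinite _))
  have h2 : ({r} : Set V).ncard + ({x | x ≠ r} : Set V).ncard = Nat.card V :=
    Set.ncard_add_ncard_compl {r}
  rw [Set.ncard_singleton] at h2
  omega

/-- A ranking of a connected graph gives a tree decomposition. -/
lemma IsRanking.exists_treeDecomposition (hf : G.IsRanking f k) (hV : V(G).Finite)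
    (hE : E(G).Finite) (hne : V(G).Nonempty) (hc : G.IsPreconnected) :
    ∃ D : G.TreeDecomposition, ∀ t, (D.bag t).ncard ≤ k + 1 := by
  classical
  have : Finite V(G) := hV
  obtain ⟨r, hr, hmin⟩ := Set.exists_min_image V(G) f hV hne
  let N : V(G) → Set α := fun x => G.outerNeighbors (G.tailComponent f x)
  have hNlt : ∀ x : V(G), ∀ y ∈ N x, f y < f x := by
    rintro x y ⟨a, e, h, ha, hy⟩
    exact lt_of_notMem_tailComponent x.2 ha h hy
  have hNfin : ∀ x, (N x).Finite := fun x => hV.subset (G.outerNeighbors_subset _)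
  -- The parent of `x` is the latest outer neighbour of its tail component; one exists because `G`
  -- is connected and `r` is ranked before `x`.
  have hpar : ∀ x : V(G), ∃ q : V(G), x ≠ ⟨r, hr⟩ → q.1 ∈ N x ∧ ∀ w ∈ N x, f w ≤ f q := by
    intro x
    by_cases hx : x = ⟨r, hr⟩
    · exact ⟨x, fun h => absurd hx h⟩
    have hlt : f r < f x := lt_of_le_of_ne (hmin x x.2) fun h =>
      hx (Subtype.ext (hf.injOn x.2 hr h.symm))
    obtain ⟨e, a, b, h, ha, hb⟩ := (hc x x.2 r hr).exists_isLink_of_mem_of_notMem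
      (G.mem_tailComponent_self f x) (notMem_tailComponent_of_lt x.2 hlt)
    obtain ⟨q, hq, hmax⟩ := Set.exists_max_image (N x) f (hNfin x) ⟨b, a, e, h, ha, hb⟩
    exact ⟨⟨q, G.outerNeighbors_subset _ hq⟩, fun _ => ⟨hq, hmax⟩⟩
  choose p hp using hpar
  obtain ⟨T, hT, hadj⟩ := exists_isTree_of_parent (⟨r, hr⟩ : V(G)) p (fun x => f x)
    (fun x hx => hNlt x _ (hp x hx).1)
  -- The tail component of `t` is contained in that of its parent, so an outer neighbour earlier
  -- than the parent remains an outer neighbour there. Hence the nodes whose bags contain `x` are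
  -- connected: climbing from any of them reaches the node `x`.
  have hstep : ∀ x t : V(G), x.1 ∈ N t → t ≠ ⟨r, hr⟩ ∧ (x = p t ∨ x.1 ∈ N (p t)) := by
    intro x t hxt
    have htr : t ≠ ⟨r, hr⟩ := by
      rintro rfl
      exact absurd (hNlt _ _ hxt) (not_lt.2 (hmin x x.2))
    refine ⟨htr, ?_⟩
    obtain ⟨hq, hmax⟩ := hp t htr
    by_cases hxp : x = p t
    · exact Or.inl hxp
    right
    have hlt : f x < f (p t) := lt_of_le_of_ne (hmax x hxt) fun h =>
      hxp (Subtype.ext (hf.injOn x.2 (p t).2 h))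
    have hlt' := hNlt t _ hq
    obtain ⟨a, e, hl, ha, -⟩ := hq
    obtain ⟨a', e', hl', ha', -⟩ := hxt
    have hsub : G.tailComponent f t ⊆ G.tailOf f (p t) := fun z hz =>
      ⟨(tailComponent_subset t.2 hz).1, hlt'.le.trans (tailComponent_subset t.2 hz).2⟩
    have hap : a ∈ G.tailComponent f (p t) :=
      mem_componentIn_of_isLink (mem_tailOf_self (p t).2) (G.mem_tailComponent_self f _) hl.symm
        (hsub ha)
    have hta : G.tailComponent f t ⊆ G.tailComponent f (p t) := by
      have h1 : t.1 ∈ G.componentIn (G.tailOf f (p t)) a :=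
        Joined.symm (componentIn_subset_of_subset hsub ha)
      have h2 := componentIn_subset_of_subset hsub
      rw [componentIn_eq_of_mem h1, componentIn_eq_of_mem hap] at h2
      exact h2
    exact ⟨a', e', hl', hta ha', notMem_tailComponent_of_lt (p t).2 hlt⟩
  refine ⟨⟨V(G), hV, T, hT, fun x => insert x.1 (N x), ?_, ?_, ?_, ?_⟩, ?_⟩
  · intro t
    exact Set.insert_subset t.2 (G.outerNeighbors_subset _)
  · intro x hx
    exact ⟨⟨x, hx⟩, Set.mem_insert _ _⟩
  · intro e x y h
    obtain hlt | heq | hlt := lt_trichotomy (f x) (f y)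
    · exact ⟨⟨y, h.right_mem⟩, Or.inr ⟨y, e, h.symm, G.mem_tailComponent_self f y,
        notMem_tailComponent_of_lt h.right_mem hlt⟩, Set.mem_insert _ _⟩
    · obtain rfl := hf.injOn h.left_mem h.right_mem heq
      exact ⟨⟨x, h.left_mem⟩, Set.mem_insert _ _, Set.mem_insert _ _⟩
    · exact ⟨⟨x, h.left_mem⟩, Set.mem_insert _ _, Or.inr ⟨x, e, h, G.mem_tailComponent_self f x,
        notMem_tailComponent_of_lt h.left_mem hlt⟩⟩
  · intro x hx
    have hreach : ∀ n, ∀ t : {t : V(G) | x ∈ insert t.1 (N t)}, f t.1 = n →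
        (T.induce {t : V(G) | x ∈ insert t.1 (N t)}).Reachable t
          ⟨⟨x, hx⟩, Set.mem_insert _ _⟩ := by
      intro n
      induction n using Nat.strong_induction_on with
      | _ n ih =>
        rintro ⟨t, ht⟩ htn
        obtain h | h := id ht
        · obtain rfl : t = ⟨x, hx⟩ := Subtype.ext h.symm
          exact SimpleGraph.Reachable.refl _
        · obtain ⟨htr, h'⟩ := hstep ⟨x, hx⟩ t h
          have hmem : x ∈ insert (p t).1 (N (p t)) := by
            obtain h' | h' := h'
            · exact Or.inl (congrArg Subtype.val h')
            · exact Or.inr h'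
          have hadj' : (T.induce {t : V(G) | x ∈ insert t.1 (N t)}).Adj ⟨t, ht⟩ ⟨p t, hmem⟩ :=
            hadj t htr
          exact hadj'.reachable.trans
            (ih _ (htn ▸ hNlt t _ (hp t htr).1) ⟨p t, hmem⟩ rfl)
    exact fun s t => (hreach _ s rfl).trans (hreach _ t rfl).symm
  · intro t
    refine (Set.ncard_insert_le _ _).trans (Nat.succ_le_succ ?_)
    exact (ncard_outerNeighbors_le hE _).trans (hf.cost_le t t.2)

lemma IsRanking.treewidth_le (hf : G.IsRanking f k) (hV : V(G).Finite)
    (hE : E(G).Finite) (hne : V(G).Nonempty) (hc : G.IsPreconnected) : G.treewidth ≤ k :=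
  Nat.sInf_le (hf.exists_treeDecomposition hV hE hne hc)

/-- The infimum defining treewidth is attained once some decomposition exists; an arbitrary ranking,
of cost at most `|E(G)|`, provides one. -/
lemma exists_treeDecomposition_treewidth (hV : V(G).Finite) (hE : E(G).Finite)
    (hne : V(G).Nonempty) (hc : G.IsPreconnected) :
    ∃ D : G.TreeDecomposition, ∀ t, (D.bag t).ncard ≤ G.treewidth + 1 := by
  obtain ⟨f, hf⟩ := exists_injOn_of_finite hV
  exact Nat.sInf_mem (s := {k | ∃ D : G.TreeDecomposition, ∀ t, (D.bag t).ncard ≤ k + 1})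
    ⟨_, (isRanking_of_injOn hE hf).exists_treeDecomposition hV hE hne hc⟩

/-! ### Degrees in two-connected graphs -/

/-- A component of the graph on the vertices after `x` is the tail component of its own earliest
vertex. -/
lemma IsRanking.ncard_edgeBoundary_componentIn_le (hf : G.IsRanking f k) (hV : V(G).Finite)
    (hy : y ∈ {z | z ∈ V(G) ∧ f x < f z}) :
    (G.edgeBoundary (G.componentIn {z | z ∈ V(G) ∧ f x < f z} y)).ncard ≤ k := by
  set S : Set α := {z | z ∈ V(G) ∧ f x < f z}
  have hKS := G.componentIn_subset hy
  obtain ⟨m, hm, hmin⟩ := Set.exists_min_image (G.componentIn S y) f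
    (hV.subset fun z hz => (hKS hz).1) ⟨y, G.self_mem_componentIn S y⟩
  have hmV := (hKS hm).1
  have heq : G.tailComponent f m = G.componentIn S y := by
    rw [← componentIn_eq_of_mem hm] at hmin ⊢
    apply Set.Subset.antisymm
    · exact componentIn_mono (T := S) le_rfl
        (fun z hz => ⟨hz.1, (hKS hm).2.trans_le hz.2⟩) m
    · exact componentIn_subset_of_subset fun z hz =>
        ⟨(G.componentIn_subset (hKS hm) hz).1, hmin z hz⟩
  rw [← heq]
  exact hf.cost_le m hmV

/-- Edges from `x` to earlier vertices already lie in the boundary of the tail component of `x`. The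
others are grouped by the component `K` of later vertices they enter. Each `K` receives at most `k`
of them and, as `x` is not a cut vertex, normally sends an edge to a vertex before `x`, to which the
group is charged. -/
lemma IsRanking.edgeDegree_le (hf : G.IsRanking f k) (hV : V(G).Finite) (hE : E(G).Finite)
    (hx : x ∈ V(G)) (hcut : (G.deleteVerts {x}).IsPreconnected) : G.edgeDegree x ≤ k ^ 2 := by
  classical
  set S : Set α := {z | z ∈ V(G) ∧ f x < f z}
  have hbfin : ∀ U, (G.edgeBoundary U).Finite := fun U => hE.subset (G.edgeBoundary_subset U)
  have hxS : x ∉ S := fun h => lt_irrefl _ h.2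
  -- Exceptional case: a component with no edge to vertices before `x`. As `x` is not a cut vertex,
  -- it contains every vertex but `x`, so its boundary contains every edge at `x`.
  by_cases hex : ∃ y ∈ S, ∀ e a b, G.IsLink e a b → a ∈ G.componentIn S y → ¬ f b < f x
  · obtain ⟨y, hy, hno⟩ := hex
    have hKS := G.componentIn_subset hy
    have hall : ∀ z ∈ V(G), z ≠ x → z ∈ G.componentIn S y := by
      intro z hz hzx
      by_contra hzK
      have hyV : y ∈ V(G.deleteVerts {x}) := by
        rw [vertexSet_deleteVerts]
        exact ⟨hy.1, fun h => hxS (h ▸ hy)⟩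
      have hzV : z ∈ V(G.deleteVerts {x}) := by
        rw [vertexSet_deleteVerts]
        exact ⟨hz, hzx⟩
      obtain ⟨e, a, b, hl, ha, hb⟩ := (hcut y hyV z hzV).exists_isLink_of_mem_of_notMem
        (G.self_mem_componentIn S y) hzK
      rw [deleteVerts_isLink] at hl
      have hbS := notMem_of_notMem_componentIn hy ha hl.1 hb
      have hle : f b ≤ f x := not_lt.1 fun h => hbS ⟨hl.1.right_mem, h⟩
      have hbx : f b ≠ f x := fun h => hl.2.2 (hf.injOn hl.1.right_mem hx h)
      exact hno e a b hl.1 ha (lt_of_le_of_ne hle hbx)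
    have hsub : G.edgeBoundary {x} ⊆ G.edgeBoundary (G.componentIn S y) := by
      rintro e ⟨a, b, hl, rfl, hb⟩
      exact ⟨b, a, hl.symm, hall b hl.right_mem hb, fun h => hxS (hKS h)⟩
    calc G.edgeDegree x ≤ _ := Set.ncard_le_ncard hsub (hbfin _)
      _ ≤ k := hf.ncard_edgeBoundary_componentIn_le hV hy
      _ ≤ k ^ 2 := Nat.le_self_pow two_ne_zero k
  push Not at hex
  obtain h0 | ⟨e₀, -⟩ := (G.edgeBoundary {x}).eq_empty_or_nonempty
  · simp [edgeDegree, h0]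
  have : Nonempty β := ⟨e₀⟩
  have hg : ∀ K : Set α, ∃ e, (∃ y ∈ S, K = G.componentIn S y) →
      ∃ a b, G.IsLink e a b ∧ a ∈ K ∧ f b < f x := by
    intro K
    by_cases hK : ∃ y ∈ S, K = G.componentIn S y
    · obtain ⟨y, hy, rfl⟩ := hK
      obtain ⟨e, a, b, h⟩ := hex y hy
      exact ⟨e, fun _ => ⟨a, b, h⟩⟩
    · exact ⟨e₀, fun h => absurd h hK⟩
  choose g hg using hg
  -- The charging map `φ` fixes the edges to earlier vertices and sends an edge entering `K` to the
  -- chosen edge `g K`.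
  have hφ : ∀ e, ∃ e', e ∈ G.edgeBoundary {x} →
      ((∃ b, G.IsLink e x b ∧ f b < f x) ∧ e' = e) ∨
      (∃ y ∈ S, G.IsLink e x y ∧ e' = g (G.componentIn S y)) := by
    intro e
    by_cases he : e ∈ G.edgeBoundary {x}
    · obtain ⟨a, b, hl, rfl, hb⟩ := he
      obtain hlt | heq | hlt := lt_trichotomy (f b) (f a)
      · exact ⟨e, fun _ => Or.inl ⟨⟨b, hl, hlt⟩, rfl⟩⟩
      · exact absurd (hf.injOn hl.right_mem hx heq) hb
      · exact ⟨_, fun _ => Or.inr ⟨b, ⟨hl.right_mem, hlt⟩, hl, rfl⟩⟩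
    · exact ⟨e, fun h => absurd h he⟩
  choose φ hφ using hφ
  have hlow : ∀ e b, G.IsLink e x b → f b < f x → e ∈ G.edgeBoundary (G.tailComponent f x) :=
    fun e b hl hb => ⟨x, b, hl, G.mem_tailComponent_self f x, notMem_tailComponent_of_lt hx hb⟩
  have hmaps : ∀ e ∈ G.edgeBoundary {x}, φ e ∈ G.edgeBoundary (G.tailComponent f x) := by
    intro e he
    obtain ⟨⟨b, hl, hb⟩, h⟩ | ⟨y, hy, hl, h⟩ := hφ e he
    · rw [h]
      exact hlow e b hl hb
    · rw [h]
      obtain ⟨a, b, hl', ha, hb⟩ := hg _ ⟨y, hy, rfl⟩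
      refine ⟨a, b, hl', ?_, notMem_tailComponent_of_lt hx hb⟩
      have hyx : y ∈ G.tailComponent f x :=
        mem_componentIn_of_isLink (mem_tailOf_self hx) (G.mem_tailComponent_self f x) hl
          ⟨hy.1, hy.2.le⟩
      rw [tailComponent, ← componentIn_eq_of_mem hyx]
      exact componentIn_mono (T := G.tailOf f x) le_rfl (fun z hz => ⟨hz.1, hz.2.le⟩) y ha
  have hfib : ∀ e' ∈ G.edgeBoundary (G.tailComponent f x),
      {e | e ∈ G.edgeBoundary {x} ∧ φ e = e'}.ncard ≤ k := by
    intro e' he'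
    by_cases hinc : ∃ b, G.IsLink e' x b
    -- An edge `g K` joins `K` to a vertex before `x`, so it misses `x`; an edge at `x` can only be
    -- charged to itself.
    · have hsub : {e | e ∈ G.edgeBoundary {x} ∧ φ e = e'} ⊆ {e'} := by
        rintro e ⟨he, rfl⟩
        obtain ⟨-, h⟩ | ⟨y, hy, hl, h⟩ := hφ e he
        · exact h.symm
        · exfalso
          rw [h] at hinc
          obtain ⟨b', hb'⟩ := hinc
          obtain ⟨a, b, hl', ha, hb⟩ := hg _ ⟨y, hy, rfl⟩
          obtain h1 | h1 := hb'.left_eq_or_eq hl'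
          · exact hxS (h1 ▸ G.componentIn_subset hy ha)
          · exact absurd hb (by simp [h1])
      calc _ ≤ ({e'} : Set β).ncard := Set.ncard_le_ncard hsub
        _ = 1 := Set.ncard_singleton _
        _ ≤ (G.edgeBoundary (G.tailComponent f x)).ncard :=
            (Set.ncard_pos (hbfin _)).2 ⟨e', he'⟩
        _ ≤ k := hf.cost_le x hx
    · obtain h0 | ⟨e, he, hee'⟩ := {e | e ∈ G.edgeBoundary {x} ∧ φ e = e'}.eq_empty_or_nonempty
      · simp [h0]
      obtain ⟨⟨b, hl, -⟩, h⟩ | ⟨y, hy, hl, h⟩ := hφ e he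
      · exact absurd ⟨b, by rw [← hee', h]; exact hl⟩ hinc
      obtain ⟨a, b, hl', ha, hb⟩ := hg _ ⟨y, hy, rfl⟩
      refine le_trans (Set.ncard_le_ncard ?_ (hbfin _))
        (hf.ncard_edgeBoundary_componentIn_le hV hy)
      rintro e₁ ⟨he₁, hee₁⟩
      obtain ⟨⟨b₁, hl₁, -⟩, h₁⟩ | ⟨y₁, hy₁, hl₁, h₁⟩ := hφ e₁ he₁
      · exact absurd ⟨b₁, by rw [← hee₁, h₁]; exact hl₁⟩ hinc
      obtain ⟨a₁, b₁, hl₁', ha₁, hb₁⟩ := hg _ ⟨y₁, hy₁, rfl⟩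
      rw [← h, hee'] at hl'
      rw [← h₁, hee₁] at hl₁'
      -- The charged edge has only one end ranked after `x`, so it determines `K`, and its fibre
      -- lies in the boundary of `K`.
      have haa : a = a₁ := by
        obtain h2 | h2 := hl'.left_eq_or_eq hl₁'
        · exact h2
        · have := (G.componentIn_subset hy ha).2
          rw [h2] at this
          omega
      have hK : G.componentIn S y₁ = G.componentIn S y := by
        rw [← componentIn_eq_of_mem ha₁, ← haa, componentIn_eq_of_mem ha]
      refine ⟨y₁, x, hl₁.symm, hK ▸ G.self_mem_componentIn S y₁, fun h => ?_⟩
      exact hxS (G.componentIn_subset hy h)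
  have hfin := hbfin {x}
  have hfin' := hbfin (G.tailComponent f x)
  have hcard := Finset.card_le_mul_card_image_of_maps_to (f := φ) (s := hfin.toFinset)
    (t := hfin'.toFinset) (by simpa using hmaps) k (by
      intro e' he'
      have := hfib e' (by simpa using he')
      rw [← Set.ncard_coe_finset]
      simpa using this)
  rw [← Set.ncard_eq_toFinset_card _ hfin, ← Set.ncard_eq_toFinset_card _ hfin'] at hcard
  calc G.edgeDegree x ≤ _ := hcard
    _ ≤ k * k := Nat.mul_le_mul_left k (hf.cost_le x hx)
    _ = k ^ 2 := (sq k).symm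

end Graph

namespace Graph

variable {α : Type u} {β : Type v} {G H : Graph α β} {S T : Set α} {x y : α} {f : α → ℕ} {k : ℕ}

/-! ### Rankings from tree decompositions -/

section Tree

variable {V : Type*} {T : SimpleGraph V}

lemma eq_of_adj_of_dist_add_one (hT : T.IsTree) {r s a b : V} (ha : T.Adj a s) (hb : T.Adj b s)
    (hda : T.dist r a + 1 = T.dist r s) (hdb : T.dist r b + 1 = T.dist r s) : a = b := by
  obtain ⟨p, hp⟩ := hT.connected.exists_walk_length_eq_dist r a
  obtain ⟨q, hq⟩ := hT.connected.exists_walk_length_eq_dist r b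
  have hp' : (p.concat ha).IsPath := SimpleGraph.Walk.isPath_of_length_eq_dist _ (by simp; omega)
  have hq' : (q.concat hb).IsPath := SimpleGraph.Walk.isPath_of_length_eq_dist _ (by simp; omega)
  have h := congrArg SimpleGraph.Walk.penultimate ((hT.existsUnique_path r s).unique hp' hq')
  simpa using h

/-- In a tree rooted at `r`, an edge leaving the set of descendants of `t` goes from `t` to its
parent. -/
lemma eq_and_dist_lt_of_adj (hT : T.IsTree) {r t s s' : V}
    (hs : T.dist r s = T.dist r t + T.dist t s) (hadj : T.Adj s s')
    (hs' : T.dist r s' ≠ T.dist r t + T.dist t s') : s = t ∧ T.dist r s' < T.dist r t := by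
  have htri := hT.connected.dist_triangle (u := r) (v := t) (w := s')
  have htri' := hT.connected.dist_triangle (u := t) (v := s) (w := s')
  rw [SimpleGraph.dist_eq_one_iff_adj.2 hadj] at htri'
  obtain h | h := hT.dist_eq_dist_add_one_of_adj r hadj
  · by_cases hst : s = t
    · subst hst
      exact ⟨rfl, by omega⟩
    -- The neighbour `s'` and the penultimate vertex of a shortest path from `t` to `s` are both one
    -- step closer to `r` than `s`, so they coincide and `s'` is a descendant of `t`.
    · exfalso
      obtain ⟨p, hp⟩ := hT.connected.exists_walk_length_eq_dist t s
      have hnil : ¬ p.Nil := SimpleGraph.Walk.not_nil_of_ne (Ne.symm hst)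
      have hadj' := p.adj_penultimate hnil
      have hle : T.dist t p.penultimate + 1 ≤ T.dist t s := by
        have h1 := SimpleGraph.dist_le p.dropLast
        have h2 := p.length_dropLast_add_one hnil
        omega
      have htri2 := hT.connected.dist_triangle (u := r) (v := t) (w := p.penultimate)
      have htri3 := hT.connected.dist_triangle (u := r) (v := p.penultimate) (w := s)
      rw [SimpleGraph.dist_eq_one_iff_adj.2 hadj'] at htri3
      have := eq_of_adj_of_dist_add_one hT (r := r) hadj.symm hadj' (by omega) (by omega)
      rw [this] at hs' h htri
      omega
  · omega

lemma forall_mem_of_induce_preconnected {W : Set V} (hW : (T.induce W).Preconnected)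
    {P : V → Prop} {s : V} (hs : s ∈ W) (hPs : P s)
    (hstep : ∀ a ∈ W, ∀ b ∈ W, T.Adj a b → P a → P b) : ∀ w ∈ W, P w := by
  intro w hw
  have h := (SimpleGraph.reachable_iff_reflTransGen _ _).1 (hW ⟨s, hs⟩ ⟨w, hw⟩)
  have key : ∀ z : W, Relation.ReflTransGen (T.induce W).Adj ⟨s, hs⟩ z → P z := by
    intro z hz
    induction hz with
    | refl => exact hPs
    | @tail b c _ hbc ih => exact hstep b b.2 c c.2 hbc ih
  exact key _ h

end Tree

/-- Every boundary edge is incident with an outer neighbour. -/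
lemma ncard_edgeBoundary_le_mul (hV : V(G).Finite) (hE : E(G).Finite) {d : ℕ}
    (hd : ∀ x ∈ V(G), G.edgeDegree x ≤ d) (S : Set α) :
    (G.edgeBoundary S).ncard ≤ (G.outerNeighbors S).ncard * d := by
  classical
  have hN : (G.outerNeighbors S).Finite := hV.subset (G.outerNeighbors_subset S)
  have hfin : ∀ U, (G.edgeBoundary U).Finite := fun U => hE.subset (G.edgeBoundary_subset U)
  have hcard := Finset.card_biUnion_le_card_mul hN.toFinset
    (fun b => (hfin {b}).toFinset) d (by
      intro b hb
      rw [← Set.ncard_eq_toFinset_card _ (hfin {b})]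
      exact hd b (G.outerNeighbors_subset S (by simpa using hb)))
  rw [← Set.ncard_eq_toFinset_card _ hN] at hcard
  refine le_trans ?_ hcard
  rw [← Set.ncard_coe_finset]
  refine Set.ncard_le_ncard ?_ (Finset.finite_toSet _)
  rintro e ⟨a, b, h, ha, hb⟩
  simp only [Finset.coe_biUnion, Set.mem_iUnion, Set.Finite.coe_toFinset, exists_prop]
  exact ⟨b, ⟨a, e, h, ha, hb⟩, b, a, h.symm, rfl, fun h' => hb (h' ▸ ha)⟩

/-- A function with prescribed order of the values `d x` can be refined to an injective one that
takes its minimum at a given minimizer of `d`. -/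
lemma exists_injOn_refining {s : Set α} (hs : s.Finite) (d : α → ℕ) {r : α} (hr : d r = 0) :
    ∃ f : α → ℕ, Set.InjOn f s ∧ (∀ x ∈ s, ∀ y ∈ s, f x ≤ f y → d x ≤ d y) ∧ ∀ y, f r ≤ f y := by
  classical
  obtain ⟨g, hg⟩ := exists_injOn_of_finite hs
  obtain ⟨M, hM⟩ := (hs.image g).bddAbove
  have hgM : ∀ x ∈ s, g x < M + 1 := fun x hx =>
    Nat.lt_succ_of_le (hM (Set.mem_image_of_mem g hx))
  -- Lexicographic order: `g ≤ M` only breaks ties of `d`, and the final `+ 1` leaves the value `0`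
  -- to `r` alone.
  let f : α → ℕ := fun x => if x = r then 0 else d x * (M + 1) + g x + 1
  have hlt : ∀ x ∈ s, ∀ y ∈ s, d x < d y → f x < f y := by
    intro x hx y hy h
    have hyr : y ≠ r := by
      rintro rfl
      omega
    have h1 : (d x + 1) * (M + 1) ≤ d y * (M + 1) := Nat.mul_le_mul_right _ h
    have h2 := hgM x hx
    rw [add_mul] at h1
    by_cases hxr : x = r
    · simp [f, hxr, hyr]
    · simp only [f, hxr, hyr, if_false]
      omega
  refine ⟨f, ?_, fun x hx y hy h => ?_, fun y => by simp [f]⟩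
  · intro x hx y hy h
    have hd : d x = d y := by
      obtain h' | h' | h' := lt_trichotomy (d x) (d y)
      · exact absurd h (hlt x hx y hy h').ne
      · exact h'
      · exact absurd h (hlt y hy x hx h').ne'
    by_cases hxr : x = r <;> by_cases hyr : y = r
    · rw [hxr, hyr]
    · simp [f, hxr, hyr] at h
    · simp [f, hxr, hyr] at h
    · simp only [f, hxr, hyr, if_false, hd] at h
      exact hg hx hy (by omega)
  · by_contra! h'
    exact absurd (hlt y hy x hx h') (not_lt.2 h)

/-- A tree decomposition gives a ranking that starts at any prescribed vertex. -/
lemma TreeDecomposition.exists_isRanking (D : G.TreeDecomposition) (hV : V(G).Finite)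
    (hE : E(G).Finite) {w d : ℕ} (hw : ∀ t, (D.bag t).ncard ≤ w + 1)
    (hd : ∀ x ∈ V(G), G.edgeDegree x ≤ d) {r : α} (hr : r ∈ V(G)) :
    ∃ f, G.IsRanking f (w * d) ∧ ∀ y ∈ V(G), f r ≤ f y := by
  classical
  obtain ⟨t₀, ht₀⟩ := D.exists_mem_bag r hr
  have : Nonempty D.Node := ⟨t₀⟩
  have hT := D.isTree
  have := D.finite_node
  have htop : ∀ x ∈ V(G), ∃ t, x ∈ D.bag t ∧
      ∀ s, x ∈ D.bag s → D.tree.dist t₀ t ≤ D.tree.dist t₀ s := by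
    intro x hx
    obtain ⟨t, ht, hmin⟩ := Set.exists_min_image {t | x ∈ D.bag t} (D.tree.dist t₀)
      (Set.toFinite _) (D.exists_mem_bag x hx)
    exact ⟨t, ht, hmin⟩
  choose! top htop hmin using htop
  have hr0 : D.tree.dist t₀ (top r) = 0 := by
    have := hmin r hr t₀ ht₀
    rw [SimpleGraph.dist_self] at this
    omega
  obtain ⟨f, hinj, hmono, hfr⟩ :=
    exists_injOn_refining hV (fun x => D.tree.dist t₀ (top x)) hr0
  refine ⟨f, ⟨hinj, fun x hx => ?_⟩, fun y _ => hfr y⟩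
  set t := top x
  let P : D.Node → Prop := fun s => D.tree.dist t₀ s = D.tree.dist t₀ t + D.tree.dist t s
  -- All bags meeting the tail component sit at descendants of `t`: leaving them leads to a node
  -- strictly shallower than `t`, while no vertex ranked at `x` or later has a bag there.
  have hdesc : ∀ y ∈ G.tailComponent f x, ∀ s, y ∈ D.bag s → P s := by
    have hclosed : ∀ z ∈ G.tailOf f x, ∀ s, z ∈ D.bag s → P s → ∀ s', z ∈ D.bag s' → P s' := by
      intro z hz s hs hPs
      refine forall_mem_of_induce_preconnected (D.bag_connected z hz.1) hs hPs ?_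
      intro a ha b hb hab hPa
      by_contra hPb
      have h1 := (eq_and_dist_lt_of_adj hT hPa hab hPb).2
      have h2 := hmin z hz.1 b hb
      have h3 : D.tree.dist t₀ t ≤ D.tree.dist t₀ (top z) := hmono x hx z hz.1 hz.2
      omega
    intro y hy
    induction hy with
    | refl => exact hclosed x (mem_tailOf_self hx) t (htop x hx) (by simp [P])
    | @tail b c _ hbc ih =>
      obtain ⟨e, he, -, hc⟩ := hbc
      obtain ⟨s, hbs, hcs⟩ := D.exists_link_bag e b c he
      exact hclosed c hc s hcs (ih s hbs)
  have hsub : G.outerNeighbors (G.tailComponent f x) ⊆ D.bag t \ {x} := by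
    rintro b ⟨a, e, hl, ha, hb⟩
    have hlt := lt_of_notMem_tailComponent hx ha hl hb
    refine ⟨?_, fun h => by rw [show b = x from h] at hlt; exact lt_irrefl _ hlt⟩
    obtain ⟨s, has, hbs⟩ := D.exists_link_bag e a b hl
    by_contra hbt
    -- If `b` avoided the bag of `t`, all its bags would be at descendants of `t`; but `b` is ranked
    -- before `x`, so its top node is no deeper than `t` and must be `t` itself.
    have hall := forall_mem_of_induce_preconnected (D.bag_connected b hl.right_mem) (P := P) hbs
      (hdesc a ha s has) (by
        intro u hu v hv huv hPu
        by_contra hPv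
        exact hbt ((eq_and_dist_lt_of_adj hT hPu huv hPv).1 ▸ hu))
    have h1 : D.tree.dist t₀ (top b) = D.tree.dist t₀ t + D.tree.dist t (top b) :=
      hall _ (htop b hl.right_mem)
    have h2 : D.tree.dist t₀ (top b) ≤ D.tree.dist t₀ t := hmono b hl.right_mem x hx hlt.le
    have h3 : D.tree.dist t (top b) = 0 := by omega
    rw [hT.connected.dist_eq_zero_iff] at h3
    exact hbt (h3 ▸ htop b hl.right_mem)
  refine (ncard_edgeBoundary_le_mul hV hE hd _).trans (Nat.mul_le_mul_right d ?_)
  have hbag : (D.bag t).Finite := hV.subset (D.bag_subset t)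
  have h1 := Set.ncard_le_ncard hsub (hbag.subset Set.sdiff_subset)
  have h2 : (D.bag t \ {x}).ncard + 1 = (D.bag t).ncard :=
    Set.ncard_sdiff_singleton_add_one (htop x hx) hbag
  have h3 := hw t
  omega

end Graph

namespace Graph

variable {α : Type u} {β : Type v} {G H : Graph α β} {A B : Set α} {x y : α} {f : α → ℕ} {k : ℕ}

/-! ### Separations of order at most one -/

/-- `A` and `B` are proper subsets covering `G` that share at most one vertex. -/
structure IsSeparation (G : Graph α β) (A B : Set α) : Prop where
  left_ssubset : A ⊂ V(G)
  right_ssubset : B ⊂ V(G)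
  union_eq : A ∪ B = V(G)
  inter_subsingleton : (A ∩ B).Subsingleton
  mem_or_mem : ∀ ⦃e a b⦄, G.IsLink e a b → (a ∈ A ∧ b ∈ A) ∨ (a ∈ B ∧ b ∈ B)

lemma IsSeparation.symm (h : G.IsSeparation A B) : G.IsSeparation B A where
  left_ssubset := h.right_ssubset
  right_ssubset := h.left_ssubset
  union_eq := by rw [Set.union_comm, h.union_eq]
  inter_subsingleton := by
    rw [Set.inter_comm]
    exact h.inter_subsingleton
  mem_or_mem _ _ _ hl := (h.mem_or_mem hl).symm

lemma Joined.mem_vertexSet (h : G.Joined x y) (hx : x ∈ V(G)) : y ∈ V(G) := by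
  induction h with
  | refl => exact hx
  | tail _ h _ => exact h.right_mem

lemma exists_isSeparation
    (h : ¬ (G.IsPreconnected ∧ ∀ x ∈ V(G), (G.deleteVerts {x}).IsPreconnected)) :
    ∃ A B, G.IsSeparation A B := by
  classical
  rw [not_and_or] at h
  obtain h | h := h
  · simp only [IsPreconnected, not_forall] at h
    obtain ⟨x, hx, y, hy, hxy⟩ := h
    have hsub : {z | G.Joined x z} ⊆ V(G) := fun z hz => Joined.mem_vertexSet hz hx
    refine ⟨{z | G.Joined x z}, V(G) \ {z | G.Joined x z}, ?_, ?_, ?_, ?_, ?_⟩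
    · exact (Set.ssubset_iff_of_subset hsub).2 ⟨y, hy, hxy⟩
    · exact (Set.ssubset_iff_of_subset Set.sdiff_subset).2
        ⟨x, hx, fun h => h.2 Relation.ReflTransGen.refl⟩
    · exact Set.union_sdiff_cancel hsub
    · rw [Set.inter_sdiff_self]
      exact Set.subsingleton_empty
    · intro e a b hl
      by_cases ha : G.Joined x a
      · exact Or.inl ⟨ha, Relation.ReflTransGen.tail ha hl.adj⟩
      · exact Or.inr ⟨⟨hl.left_mem, ha⟩, hl.right_mem,
          fun hb => ha (Relation.ReflTransGen.tail hb hl.symm.adj)⟩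
  · simp only [IsPreconnected, not_forall] at h
    obtain ⟨x, hx, y, hy, z, hz, hyz⟩ := h
    set K : Set α := {w | (G.deleteVerts {x}).Joined y w}
    have hKsub : ∀ w ∈ K, w ∈ V(G) ∧ w ≠ x := fun w hw => by
      have := Joined.mem_vertexSet hw hy
      rw [vertexSet_deleteVerts] at this
      exact this
    rw [vertexSet_deleteVerts] at hy hz
    have hstep : ∀ ⦃e a b⦄, G.IsLink e a b → a ∈ K → b = x ∨ b ∈ K := by
      intro e a b hl ha
      by_cases hb : b = x
      · exact Or.inl hb
      · refine Or.inr (Relation.ReflTransGen.tail ha ⟨e, ?_⟩)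
        rw [deleteVerts_isLink]
        exact ⟨hl, (hKsub a ha).2, hb⟩
    have hxK : x ∉ K := fun h => (hKsub x h).2 rfl
    -- The cut vertex `x` belongs to both sides, as it is not in `K`.
    refine ⟨insert x K, V(G) \ K, ?_, ?_, ?_, ?_, ?_⟩
    · refine (Set.ssubset_iff_of_subset (Set.insert_subset hx fun w hw => (hKsub w hw).1)).2
        ⟨z, hz.1, ?_⟩
      rintro (h | h)
      · exact hz.2 h
      · exact hyz h
    · exact (Set.ssubset_iff_of_subset Set.sdiff_subset).2
        ⟨y, hy.1, fun h => h.2 Relation.ReflTransGen.refl⟩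
    · ext w
      by_cases hw : w ∈ K
      · simp [hw, (hKsub w hw).1]
      · simp only [Set.mem_union, Set.mem_insert_iff, hw, or_false, Set.mem_sdiff,
          not_false_eq_true, and_true, or_iff_right_iff_imp]
        rintro rfl
        exact hx
    · rintro a ⟨ha | ha, ha'⟩ b ⟨hb | hb, hb'⟩
      · rw [ha, hb]
      · exact absurd hb hb'.2
      · exact absurd ha ha'.2
      · exact absurd hb hb'.2
    · intro e a b hl
      by_cases ha : a ∈ K
      · exact Or.inl ⟨Or.inr ha, hstep hl ha⟩
      by_cases hb : b ∈ K
      · exact Or.inl ⟨hstep hl.symm hb, Or.inr hb⟩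
      · exact Or.inr ⟨⟨hl.left_mem, ha⟩, hl.right_mem, hb⟩

/-- Walks across sets sharing at most one vertex can be retracted to one of them. -/
lemma reflTransGen_retract {R : α → α → Prop} (hAB : (A ∩ B).Subsingleton)
    (hR : ∀ a b, R a b → (a ∈ A ∧ b ∈ A) ∨ (a ∈ B ∧ b ∈ B)) (hx : x ∈ A)
    (h : Relation.ReflTransGen R x y) :
    (y ∈ A → Relation.ReflTransGen (fun a b => R a b ∧ a ∈ A ∧ b ∈ A) x y) ∧
    (y ∉ A → ∃ c ∈ A ∩ B, Relation.ReflTransGen (fun a b => R a b ∧ a ∈ A ∧ b ∈ A) x c) := by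
  induction h with
  | refl => exact ⟨fun _ => Relation.ReflTransGen.refl, fun h => absurd hx h⟩
  | @tail a b _ hab ih =>
    obtain ⟨ha, hb⟩ | ⟨ha, hb⟩ := hR a b hab
    · exact ⟨fun _ => (ih.1 ha).tail ⟨hab, ha, hb⟩, fun h => absurd hb h⟩
    · by_cases haA : a ∈ A <;> by_cases hbA : b ∈ A
      · obtain rfl := hAB ⟨haA, ha⟩ ⟨hbA, hb⟩
        exact ⟨ih.1, fun h => absurd hbA h⟩
      · exact ⟨fun h => absurd h hbA, fun _ => ⟨a, ⟨haA, ha⟩, ih.1 haA⟩⟩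
      · obtain ⟨c, hc, h⟩ := ih.2 haA
        obtain rfl := hAB hc ⟨hbA, hb⟩
        exact ⟨fun _ => h, fun h' => absurd hbA h'⟩
      · exact ⟨fun h => absurd h hbA, fun _ => ih.2 haA⟩

lemma IsSeparation.joined_deleteEdges_induce {e : β} (h : G.IsSeparation A B) (hx : x ∈ A)
    (hy : y ∈ A) (hj : (G.deleteEdges {e}).Joined x y) :
    ((G.induce A).deleteEdges {e}).Joined x y := by
  have hR : ∀ a b, (G.deleteEdges {e}).Adj a b → (a ∈ A ∧ b ∈ A) ∨ (a ∈ B ∧ b ∈ B) := by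
    rintro a b ⟨e', he'⟩
    exact h.mem_or_mem (he'.mono deleteEdges_le)
  refine Relation.ReflTransGen.mono ?_ _ _
    ((reflTransGen_retract h.inter_subsingleton hR hx hj).1 hy)
  rintro a b ⟨⟨e', he'⟩, ha, hb⟩
  exact ⟨e', ⟨he'.1, ha, hb⟩, he'.2⟩

/-- Rankings of the two sides of a separation combine, if the second one starts at the common
vertex. -/
lemma IsSeparation.exists_isRanking (h : G.IsSeparation A B) (hV : V(G).Finite) (hE : E(G).Finite)
    {f₁ f₂ : α → ℕ} {r c : α} (h₁ : (G.induce A).IsRanking f₁ k) (hr : r ∈ A)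
    (hr₁ : ∀ y ∈ A, f₁ r ≤ f₁ y) (h₂ : (G.induce B).IsRanking f₂ k)
    (hcAB : A ∩ B ⊆ {c}) (hc₂ : ∀ y ∈ B, f₂ c ≤ f₂ y) :
    ∃ f, G.IsRanking f k ∧ ∀ y ∈ V(G), f r ≤ f y := by
  classical
  obtain ⟨M, hM⟩ := ((hV.subset h.left_ssubset.subset).image f₁).bddAbove
  have hlt : ∀ a ∈ A, f₁ a < M + 1 := fun a ha =>
    Nat.lt_succ_of_le (hM (Set.mem_image_of_mem f₁ ha))
  have hA : A ⊆ V(G) := h.left_ssubset.subset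
  have hB : B ⊆ V(G) := h.right_ssubset.subset
  have hmemB : ∀ y ∈ V(G), y ∉ A → y ∈ B := fun y hy hyA =>
    ((h.union_eq.symm ▸ hy : y ∈ A ∪ B)).resolve_left hyA
  -- All of `A` comes first, including the common vertex, followed by the rest of `B`.
  let f : α → ℕ := fun y => if y ∈ A then f₁ y else M + 1 + f₂ y
  have hfA : ∀ y ∈ A, f y = f₁ y := fun y hy => if_pos hy
  have hfB : ∀ y ∉ A, f y = M + 1 + f₂ y := fun y hy => if_neg hy
  have hfin : ∀ (X : Set α) U, ((G.induce X).edgeBoundary U).Finite := by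
    intro X U
    refine hE.subset ?_
    rintro e ⟨a, b, hl, -⟩
    exact hl.1.edge_mem
  refine ⟨f, ⟨?_, ?_⟩, ?_⟩
  · intro a ha b hb hab
    by_cases haA : a ∈ A <;> by_cases hbA : b ∈ A
    · rw [hfA a haA, hfA b hbA] at hab
      exact h₁.injOn haA hbA hab
    · rw [hfA a haA, hfB b hbA] at hab
      have := hlt a haA
      omega
    · rw [hfB a haA, hfA b hbA] at hab
      have := hlt b hbA
      omega
    · rw [hfB a haA, hfB b hbA] at hab
      exact h₂.injOn (hmemB a ha haA) (hmemB b hb hbA) (by omega)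
  · intro x hx
    by_cases hxA : x ∈ A
    · refine le_trans (Set.ncard_le_ncard ?_ (hfin A _)) (h₁.cost_le x hxA)
      have hR : ∀ a b, (G.induce (G.tailOf f x)).Adj a b →
          (a ∈ A ∧ b ∈ A) ∨ (a ∈ B ∧ b ∈ B) := by
        rintro a b ⟨e, he⟩
        exact h.mem_or_mem he.1
      have hle : ∀ y, Relation.ReflTransGen
          (fun a b => (G.induce (G.tailOf f x)).Adj a b ∧ a ∈ A ∧ b ∈ A) x y →
          y ∈ (G.induce A).tailComponent f₁ x := by
        intro y hy
        refine Relation.ReflTransGen.mono ?_ _ _ hy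
        rintro a b ⟨⟨e, hl, ha, hb⟩, haA, hbA⟩
        refine ⟨e, ⟨hl, haA, hbA⟩, ⟨haA, ?_⟩, hbA, ?_⟩
        · rw [← hfA x hxA, ← hfA a haA]
          exact ha.2
        · rw [← hfA x hxA, ← hfA b hbA]
          exact hb.2
      rintro e ⟨a, b, hl, ha, hb⟩
      have hba := lt_of_notMem_tailComponent hx ha hl hb
      have hbA : b ∈ A := by
        by_contra hbA
        rw [hfA x hxA, hfB b hbA] at hba
        have := hlt x hxA
        omega
      have hb₁ : f₁ b < f₁ x := by rwa [hfA x hxA, hfA b hbA] at hba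
      have hbC : b ∉ (G.induce A).tailComponent f₁ x := notMem_tailComponent_of_lt hxA hb₁
      have hret := reflTransGen_retract h.inter_subsingleton hR hxA ha
      by_cases haA : a ∈ A
      · exact ⟨a, b, ⟨hl, haA, hbA⟩, hle a (hret.1 haA), hbC⟩
      -- An edge from outside `A` back into `A` ends at the common vertex, through which the walk to
      -- `a` already passed; so `b` would lie in the component.
      · exfalso
        obtain ⟨c', hc', hj⟩ := hret.2 haA
        obtain h' | h' := h.mem_or_mem hl
        · exact haA h'.1
        · obtain rfl := h.inter_subsingleton hc' ⟨hbA, h'.2⟩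
          exact hbC (hle _ hj)
    · have hxB := hmemB x hx hxA
      have htail : G.tailOf f x ⊆ (G.induce B).tailOf f₂ x ∩ Aᶜ := by
        rintro y ⟨hy, hxy⟩
        have hyA : y ∉ A := by
          intro hyA
          rw [hfB x hxA, hfA y hyA] at hxy
          have := hlt y hyA
          omega
        rw [hfB x hxA, hfB y hyA] at hxy
        exact ⟨⟨hmemB y hy hyA, by omega⟩, hyA⟩
      refine le_trans (Set.ncard_le_ncard ?_ (hfin B _)) (h₂.cost_le x hxB)
      rintro e ⟨a, b, hl, ha, hb⟩
      have hba := lt_of_notMem_tailComponent hx ha hl hb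
      have haA := (htail (tailComponent_subset hx ha)).2
      have hlB : a ∈ B ∧ b ∈ B := (h.mem_or_mem hl).resolve_left fun h' => haA h'.1
      refine ⟨a, b, ⟨hl, hlB⟩, ?_, notMem_tailComponent_of_lt hxB ?_⟩
      · refine Relation.ReflTransGen.mono ?_ _ _ ha
        rintro p q ⟨e', hl', hp, hq⟩
        exact ⟨e', ⟨hl', (htail hp).1.1, (htail hq).1.1⟩, (htail hp).1, (htail hq).1⟩
      · by_cases hbA : b ∈ A
        -- Moving the common vertex to the front does not disturb the second ranking, since it is
        -- already first there.
        · have hbc : b = c := hcAB ⟨hbA, hlB.2⟩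
          refine lt_of_le_of_ne (hbc ▸ hc₂ x hxB) fun heq => ?_
          exact hxA (h₂.injOn hlB.2 hxB heq ▸ hbA)
        · rw [hfB x hxA, hfB b hbA] at hba
          omega
  · intro y hy
    rw [hfA r hr]
    by_cases hyA : y ∈ A
    · rw [hfA y hyA]
      exact hr₁ y hyA
    · rw [hfB y hyA]
      have := hlt r hr
      omega

lemma Loopless.of_le (hG : G.Loopless) (hHG : H ≤ G) : H.Loopless :=
  ⟨fun e x h => hG.not_isLoopAt e x (h.mono hHG)⟩

/-- An edge that is not a bridge yields a 2-connected subgraph. -/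
lemma exists_isTwoConnected_of_joined (n : ℕ) :
    ∀ G : Graph α β, V(G).ncard = n → V(G).Finite → G.Loopless → ∀ e x y, G.IsLink e x y →
      (G.deleteEdges {e}).Joined x y → ∃ H ≤ G, H.IsTwoConnected := by
  induction n using Nat.strong_induction_on with
  | _ n ih =>
    intro G hn hV hloop e x y hl hj
    by_cases hG : G.IsPreconnected ∧ ∀ x ∈ V(G), (G.deleteVerts {x}).IsPreconnected
    · refine ⟨G, le_rfl, hG.1, hG.2, ?_⟩
      -- The walk from `x` to `y` avoiding `e` supplies the required second edge.
      obtain ⟨e', a, b, hl', -⟩ := hj.exists_isLink_of_mem_of_notMem (S := {x}) rfl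
        (fun h => hl.ne (show y = x from h).symm)
      exact ⟨e', hl'.1.edge_mem, e, hl.edge_mem, hl'.2⟩
    · obtain ⟨A, B, hAB⟩ := exists_isSeparation hG
      have key : ∀ A B, G.IsSeparation A B → x ∈ A → y ∈ A → ∃ H ≤ G, H.IsTwoConnected := by
        intro A B hAB hx hy
        have hle : G.induce A ≤ G := induce_le hAB.left_ssubset.subset
        obtain ⟨H, hH, hH2⟩ := ih _ (hn ▸ Set.ncard_lt_ncard hAB.left_ssubset hV) (G.induce A) rfl
          (hV.subset hAB.left_ssubset.subset) (Loopless.of_le hloop hle) e x y ⟨hl, hx, hy⟩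
          (hAB.joined_deleteEdges_induce hx hy hj)
        exact ⟨H, hH.trans hle, hH2⟩
      obtain ⟨hx, hy⟩ | ⟨hx, hy⟩ := hAB.mem_or_mem hl
      · exact key A B hAB hx hy
      · exact key B A hAB.symm hx hy

/-- Rankings of the 2-connected subgraphs combine to a ranking of the graph. -/
lemma exists_isRanking_of_isTwoConnected (n : ℕ) :
    ∀ G : Graph α β, V(G).ncard = n → V(G).Finite → E(G).Finite → (E(G).Nonempty → 1 ≤ k) →
      (∀ H ≤ G, H.IsTwoConnected → ∀ r ∈ V(H), ∃ f, H.IsRanking f k ∧ ∀ y ∈ V(H), f r ≤ f y) →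
      ∀ r ∈ V(G), ∃ f, G.IsRanking f k ∧ ∀ y ∈ V(G), f r ≤ f y := by
  induction n using Nat.strong_induction_on with
  | _ n ih =>
    intro G hn hV hE hk h2 r hr
    by_cases hG : G.IsPreconnected ∧ ∀ x ∈ V(G), (G.deleteVerts {x}).IsPreconnected
    · by_cases hnt : E(G).Nontrivial
      · exact h2 G le_rfl ⟨hG.1, hG.2, hnt⟩ r hr
      · obtain ⟨f, hf, -, hmin⟩ := exists_injOn_refining hV (fun _ => 0) (r := r) rfl
        refine ⟨f, (isRanking_of_injOn hE hf).mono ?_, fun y _ => hmin y⟩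
        obtain h0 | h0 := E(G).eq_empty_or_nonempty
        · simp [h0]
        · exact ((Set.ncard_le_one hE).2 fun a ha b hb =>
            Set.not_nontrivial_iff.1 hnt ha hb).trans (hk h0)
    · obtain ⟨A, B, hAB⟩ := exists_isSeparation hG
      have side : ∀ A B, G.IsSeparation A B → ∀ r ∈ A,
          ∃ f, (G.induce A).IsRanking f k ∧ ∀ y ∈ A, f r ≤ f y := by
        intro A B hAB r hr
        have hle : G.induce A ≤ G := induce_le hAB.left_ssubset.subset
        exact ih _ (hn ▸ Set.ncard_lt_ncard hAB.left_ssubset hV) (G.induce A) rfl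
          (hV.subset hAB.left_ssubset.subset) (hE.subset hle.edgeSet_mono)
          (fun h => hk (h.mono hle.edgeSet_mono)) (fun H hH => h2 H (hH.trans hle)) r hr
      have key : ∀ A B, G.IsSeparation A B → r ∈ A →
          ∃ f, G.IsRanking f k ∧ ∀ y ∈ V(G), f r ≤ f y := by
        intro A B hAB hr
        -- When the sides are disjoint, any vertex of `B` may start the second ranking.
        obtain ⟨c, hc, hcAB⟩ : ∃ c ∈ B, A ∩ B ⊆ {c} := by
          obtain h0 | ⟨c, hc⟩ := (A ∩ B).eq_empty_or_nonempty
          · obtain ⟨z, hz, hzA⟩ := Set.exists_of_ssubset hAB.left_ssubset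
            rw [← hAB.union_eq] at hz
            exact ⟨z, hz.resolve_left hzA, by simp [h0]⟩
          · exact ⟨c, hc.2, fun z hz => hAB.inter_subsingleton hz hc⟩
        obtain ⟨f₁, h₁, hr₁⟩ := side A B hAB r hr
        obtain ⟨f₂, h₂, hr₂⟩ := side B A hAB.symm c hc
        exact hAB.exists_isRanking hV hE h₁ hr hr₁ h₂ hcAB hr₂
      rw [← hAB.union_eq] at hr
      obtain hr | hr := hr
      · exact key A B hAB hr
      · exact key B A hAB.symm hr

/-! ### Blocks -/

lemma edgeDegree_le_maxEdgeDegree (hE : E(G).Finite) (hx : x ∈ V(G)) :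
    G.edgeDegree x ≤ G.maxEdgeDegree := by
  refine le_csSup ⟨E(G).ncard, ?_⟩ ⟨x, hx, rfl⟩
  rintro _ ⟨y, -, rfl⟩
  exact Set.ncard_le_ncard (G.edgeBoundary_subset _) hE

lemma maxEdgeDegree_le (h : ∀ x ∈ V(G), G.edgeDegree x ≤ k) : G.maxEdgeDegree ≤ k := by
  refine csSup_le' ?_
  rintro _ ⟨x, hx, rfl⟩
  exact h x hx

lemma one_le_maxEdgeDegree (hE : E(G).Finite) (hloop : G.Loopless) (hne : E(G).Nonempty) :
    1 ≤ G.maxEdgeDegree := by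
  obtain ⟨e, he⟩ := hne
  obtain ⟨x, y, hl⟩ := exists_isLink_of_mem_edgeSet he
  refine le_trans ?_ (edgeDegree_le_maxEdgeDegree hE hl.left_mem)
  exact (Set.ncard_pos (hE.subset (G.edgeBoundary_subset _))).2
    ⟨e, x, y, hl, rfl, fun h => hl.ne (show y = x from h).symm⟩

lemma banana_le {e : β} (h : G.IsLink e x y) : banana x y {e} ≤ G := by
  refine ⟨?_, ?_⟩
  · rintro z (rfl | rfl)
    · exact h.left_mem
    · exact h.right_mem
  · rintro e' a b ⟨rfl, ⟨rfl, rfl⟩ | ⟨rfl, rfl⟩⟩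
    · exact h
    · exact h.symm

lemma IsBlock.le {B : Graph α β} (h : G.IsBlock B) : B ≤ G := by
  obtain ⟨e, x, y, -, hl, rfl⟩ | h := h
  · exact banana_le hl
  · exact h.prop.1

end Graph

namespace Graph

variable {α : Type u} {β : Type v} {G H B : Graph α β} {x y : α} {f : α → ℕ} {k : ℕ}

lemma finite_setOf_le (hV : V(G).Finite) (hE : E(G).Finite) : {H | H ≤ G}.Finite := by
  refine Set.Finite.of_injOn (f := fun H : Graph α β => (V(H), E(H)))
    (t := 𝒫 V(G) ×ˢ 𝒫 E(G)) ?_ ?_ (hV.powerset.prod hE.powerset)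
  · intro H hH
    exact ⟨IsSubgraph.vertexSet_mono hH, IsSubgraph.edgeSet_mono hH⟩
  · intro H hH K hK h
    rw [Prod.mk.injEq] at h
    exact Compatible.ext h.1 h.2 (Compatible.of_le_le hH hK)

lemma IsTwoConnected.exists_isBlock (hH : H.IsTwoConnected) (hHG : H ≤ G) (hV : V(G).Finite)
    (hE : E(G).Finite) : ∃ B, H ≤ B ∧ G.IsBlock B ∧ B.IsTwoConnected := by
  obtain ⟨B, hHB, hB⟩ := ((finite_setOf_le hV hE).subset
    (fun K (hK : K ∈ {K : Graph α β | K ≤ G ∧ K.IsTwoConnected}) => hK.1)).exists_le_maximal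
    (show H ∈ {K : Graph α β | K ≤ G ∧ K.IsTwoConnected} from ⟨hHG, hH⟩)
  exact ⟨B, hHB, Or.inr hB, hB.prop.2⟩

lemma IsTwoConnected.vertexSet_nonempty (h : G.IsTwoConnected) : V(G).Nonempty := by
  obtain ⟨e, he⟩ := h.two_edges.nonempty
  obtain ⟨x, y, hl⟩ := exists_isLink_of_mem_edgeSet he
  exact ⟨x, hl.left_mem⟩

lemma IsRanking.one_le (hf : G.IsRanking f k) (hE : E(G).Finite) (hloop : G.Loopless)
    (hne : E(G).Nonempty) : 1 ≤ k := by
  obtain ⟨e, he⟩ := hne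
  obtain ⟨x, y, hl⟩ := exists_isLink_of_mem_edgeSet he
  have key : ∀ a b, G.IsLink e a b → f a < f b → 1 ≤ k := fun a b hab hlt =>
    le_trans ((Set.ncard_pos (hE.subset (G.edgeBoundary_subset _))).2
      ⟨e, b, a, hab.symm, G.mem_tailComponent_self f b,
        notMem_tailComponent_of_lt hab.right_mem hlt⟩) (hf.cost_le b hab.right_mem)
  obtain h | h | h := lt_trichotomy (f x) (f y)
  · exact key x y hl h
  · exact absurd (hf.injOn hl.left_mem hl.right_mem h) hl.ne
  · exact key y x hl.symm h

lemma banana_isPreconnected (x y : α) (e : β) : (banana x y {e}).IsPreconnected := by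
  have h : (banana x y {e}).Adj x y := ⟨e, rfl, Or.inl ⟨rfl, rfl⟩⟩
  rintro a (rfl | rfl) b (rfl | rfl)
  · exact Relation.ReflTransGen.refl
  · exact Relation.ReflTransGen.single h
  · exact Relation.ReflTransGen.single h.symm
  · exact Relation.ReflTransGen.refl

/-- The treewidth and the edge-degrees of a block are bounded by the square of the cost of a
ranking. -/
lemma IsBlock.treewidth_le_and_maxEdgeDegree_le (hB : G.IsBlock B) (hV : V(G).Finite)
    (hE : E(G).Finite) (hloop : G.Loopless) (hf : G.IsRanking f k) :
    B.treewidth ≤ k ^ 2 ∧ B.maxEdgeDegree ≤ k ^ 2 := by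
  have hle := hB.le
  have hVB := hV.subset hle.vertexSet_mono
  have hEB := hE.subset hle.edgeSet_mono
  have hfB := hf.anti hE hle
  have hkk : k ≤ k ^ 2 := Nat.le_self_pow two_ne_zero k
  obtain ⟨e, x, y, -, hl, rfl⟩ | hmax := hB
  · refine ⟨(hfB.treewidth_le hVB hEB ⟨x, Or.inl rfl⟩ (banana_isPreconnected x y e)).trans hkk,
      maxEdgeDegree_le fun z _ => ?_⟩
    have h1 : (banana x y {e}).edgeDegree z ≤ ({e} : Set β).ncard :=
      Set.ncard_le_ncard (edgeBoundary_subset _ _)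
    rw [Set.ncard_singleton] at h1
    exact h1.trans ((hf.one_le hE hloop ⟨e, hl.edge_mem⟩).trans hkk)
  · have h2 := hmax.prop.2
    exact ⟨(hfB.treewidth_le hVB hEB h2.vertexSet_nonempty h2.preconnected).trans hkk,
      maxEdgeDegree_le fun z hz =>
        hfB.edgeDegree_le hVB hEB hz (h2.deleteVert_preconnected z hz)⟩

/-! ### The two quadratic inequalities between edge-treewidth and the block parameter. -/

lemma blockParameter_le_sq (hV : V(G).Finite) (hE : E(G).Finite) (hloop : G.Loopless) :
    G.blockParameter ≤ G.edgeTreewidth ^ 2 := by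
  obtain ⟨f, hf⟩ := exists_isRanking_edgeTreewidth hV hE
  refine csSup_le' ?_
  rintro _ ⟨B, hB, rfl | rfl⟩
  · exact (hB.treewidth_le_and_maxEdgeDegree_le hV hE hloop hf).1
  · exact (hB.treewidth_le_and_maxEdgeDegree_le hV hE hloop hf).2

lemma IsBlock.le_blockParameter (hB : G.IsBlock B) (hV : V(G).Finite) (hE : E(G).Finite)
    (hloop : G.Loopless) :
    B.treewidth ≤ G.blockParameter ∧ B.maxEdgeDegree ≤ G.blockParameter := by
  obtain ⟨f, hf⟩ := exists_isRanking_edgeTreewidth hV hE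
  -- Boundedness is needed because `sSup` of an unbounded set of naturals is `0`.
  have hbdd : BddAbove {n | ∃ B, G.IsBlock B ∧ (n = B.treewidth ∨ n = B.maxEdgeDegree)} := by
    refine ⟨G.edgeTreewidth ^ 2, ?_⟩
    rintro _ ⟨B, hB, rfl | rfl⟩
    · exact (hB.treewidth_le_and_maxEdgeDegree_le hV hE hloop hf).1
    · exact (hB.treewidth_le_and_maxEdgeDegree_le hV hE hloop hf).2
  exact ⟨le_csSup hbdd ⟨B, hB, Or.inl rfl⟩, le_csSup hbdd ⟨B, hB, Or.inr rfl⟩⟩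

/-- Needed for pieces with a single edge, which have cost `1` and are not 2-connected. Any edge
gives a block with an edge: either it is a bridge, or its ends stay joined without it and a
2-connected subgraph exists. -/
lemma one_le_blockParameter (hV : V(G).Finite) (hE : E(G).Finite) (hloop : G.Loopless)
    (hne : E(G).Nonempty) : 1 ≤ G.blockParameter := by
  suffices h : ∃ B, G.IsBlock B ∧ E(B).Nonempty by
    obtain ⟨B, hB, hBne⟩ := h
    exact (one_le_maxEdgeDegree (hE.subset hB.le.edgeSet_mono) (Loopless.of_le hloop hB.le)
      hBne).trans (hB.le_blockParameter hV hE hloop).2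
  obtain ⟨e, he⟩ := hne
  obtain ⟨x, y, hl⟩ := exists_isLink_of_mem_edgeSet he
  by_cases hj : (G.deleteEdges {e}).Joined x y
  · obtain ⟨H, hHG, hH⟩ := exists_isTwoConnected_of_joined _ G rfl hV hloop e x y hl hj
    obtain ⟨B, -, hB, hB2⟩ := hH.exists_isBlock hHG hV hE
    exact ⟨B, hB, hB2.two_edges.nonempty⟩
  · exact ⟨banana x y {e}, Or.inl ⟨e, x, y, ⟨x, y, hl, hj⟩, hl, rfl⟩, ⟨e, rfl⟩⟩

lemma edgeTreewidth_le_sq (hV : V(G).Finite) (hE : E(G).Finite) (hloop : G.Loopless) :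
    G.edgeTreewidth ≤ G.blockParameter ^ 2 := by
  have h2 : ∀ H ≤ G, H.IsTwoConnected → ∀ r ∈ V(H),
      ∃ f, H.IsRanking f (G.blockParameter ^ 2) ∧ ∀ y ∈ V(H), f r ≤ f y := by
    intro H hHG hH r hr
    -- The gluing also meets 2-connected subgraphs that are not known to be maximal; these inherit a
    -- ranking from a block containing them.
    obtain ⟨B, hHB, hB, hB2⟩ := hH.exists_isBlock hHG hV hE
    have hVB := hV.subset hB.le.vertexSet_mono
    have hEB := hE.subset hB.le.edgeSet_mono
    obtain ⟨htw, hdeg⟩ := hB.le_blockParameter hV hE hloop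
    obtain ⟨D, hD⟩ := exists_treeDecomposition_treewidth hVB hEB hB2.vertexSet_nonempty
      hB2.preconnected
    obtain ⟨f, hf, hmin⟩ := D.exists_isRanking hVB hEB hD
      (fun x hx => edgeDegree_le_maxEdgeDegree hEB hx) (hHB.vertexSet_mono hr)
    refine ⟨f, (hf.mono ?_).anti hEB hHB, fun y hy => hmin y (hHB.vertexSet_mono hy)⟩
    rw [sq]
    exact Nat.mul_le_mul htw hdeg
  obtain h0 | ⟨r, hr⟩ := V(G).eq_empty_or_nonempty
  · refine IsRanking.edgeTreewidth_le (f := fun _ => 0) hV ⟨?_, ?_⟩ <;> simp [h0]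
  · obtain ⟨f, hf, -⟩ := exists_isRanking_of_isTwoConnected _ G rfl hV hE
      (fun hne => Nat.one_le_pow _ _ (one_le_blockParameter hV hE hloop hne)) h2 r hr
    exact hf.edgeTreewidth_le hV

end Graph

theorem mainTheorem2 :
    GraphParameter.ParametricallyEquivalent.{u, v}
      (fun _ _ G => G.edgeTreewidth) (fun _ _ G => G.blockParameter) ∧
    ∀ (α : Type u) (β : Type v) (G : Graph α β),
      G.vertexSet.Finite → G.edgeSet.Finite → G.Loopless →
        Real.sqrt (G.blockParameter : ℝ) ≤ (G.edgeTreewidth : ℝ) ∧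
        G.edgeTreewidth ≤ G.blockParameter ^ 4 + 2 * G.blockParameter ^ 2 := by
  refine ⟨⟨⟨fun n => n ^ 2, fun α β G hV hE hloop => Graph.blockParameter_le_sq hV hE hloop⟩,
    ⟨fun n => n ^ 2, fun α β G hV hE hloop => Graph.edgeTreewidth_le_sq hV hE hloop⟩⟩,
    fun α β G hV hE hloop => ⟨?_, ?_⟩⟩
  · rw [Real.sqrt_le_left (Nat.cast_nonneg _)]
    exact_mod_cast Graph.blockParameter_le_sq hV hE hloop
  · have := Graph.edgeTreewidth_le_sq hV hE hloop
    omega
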